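/- Conventions. A polytope $P$ is the convex hull of a nonempty finite set of points in a finite-dimensional real vector space; $\mathcal F(P)$ is the set of its nonempty faces ($P$ included), $\mathrm{vert}(F)$ is the vertex set of a face $F$, and a $d$-polytope is one of dimension $d$. A triangulation of $P$ is a finite geometric simplicial complex with underlying set $P$. Pointed triangulations. Let $\mathcal C_P$ be a triangulation of $P$, and for $F\in\mathcal F(P)$ let $\mathcal C_F$ be the set of simplices of $\mathcal C_P$ contained in $F$. Given a family $V(P)=(\mathbf v_F)_{F\in\mathcal F(P)}$ of apexes $\mathbf v_F\in \mathrm{vert}(F)$, $\mathcal C_P$ is the $V(P)$-pointed triangulation if (1) for every $k$ and every $k$-face $F$, $\mathcal C_F$ is a triangulation of $F$ in which every simplex is a face of a $k$-simplex, and $\mathbf v_F$ lies in every $k$-simplex of $\mathcal C_F$; (2) for any faces $F_1,F_2$, if $\mathbf v_{F_1},\mathbf v_{F_2}\in F_1\cap F_2$ then $\mathbf v_{F_1}=\mathbf v_{F_2}$; (3) for every face $F$ and every $\mathbf w\in \mathrm{vert}(F)\setminus\{\mathbf v_F\}$ the edge $\mathrm{conv}\{\mathbf v_F,\mathbf w\}$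 is in $\mathcal C_F$. Polytope numbers. For apexes $V(P)$ satisfying (2), the $V(P)$-polytope numbers $P(n)$ and interior polytope numbers $P(n)^\sharp$ ($n\ge 0$) are defined by induction on $\dim P$ and $n$, each face $F$ of $P$ carrying the apexes of its own faces. If $\dim P=0$, then $P(0)=P(0)^\sharp=0$ and $P(n)=P(n)^\sharp=1$ for $n\ge1$. If $\dim P\ge 1$, then $P(0)=0$, $P(1)=1$, $P(0)^\sharp=P(1)^\sharp=0$, and for $n\ge2$ $$P(n)=P(n-1)+\sum_{F\in\mathcal F(P),\ \mathbf v_P\notin F}F(n)^\sharp,\qquad P(n)^\sharp=P(n)-\sum_{F\in\mathcal F(P)\setminus\{P\}}F(n)^\sharp .$$ For $k\ge 0$ let $\alpha^k(n)$ denote the polytope numbers of a $k$-simplex (any $k$-simplex and any apexes satisfying (2) may be used), and set $\alpha^k(m)=0$ for $m<0$. Theorem (Decomposition theorem 4). Let $P$ be a $d$-polytope with the $V(P)$-pointed triangulation $\mathcal C_P$, let $P(n)$ be the $V(P)$-polytope numbers, and for $0\le k\le d$ let $d_k$ be the number of $k$-simplices in $\mathcal C_P$. Then for every integer $n\ge 0$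 with $n\ne 1$, $$P(n)=\sum_{k=0}^{d}d_k\,\alpha^k\bigl(n-(k+1)\bigr).$$ -/

import Mathlib

namespace Polytope

noncomputable section

variable {E : Type*} [NormedAddCommGroup E] [NormedSpace ℝ E]

/-- A nonempty (convex) polytope: the convex hull of a nonempty finite set of points. -/
def IsPolytope (P : Set E) : Prop :=
  ∃ s : Finset E, s.Nonempty ∧ P = convexHull ℝ (s : Set E)

/-- The dimension of (the affine hull of) a nonempty set. -/
def dim (P : Set E) : ℕ := Module.finrank ℝ (vectorSpan ℝ P)

/-- The nonempty faces of `P`, the face `P` itself included: the sets of points of `P` at which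
a linear functional attains its maximum over `P`. -/
def faces (P : Set E) : Set (Set E) := {F | F.Nonempty ∧ IsExposed ℝ P F}

/-- The nonempty faces of `P` other than `P`. -/
def properFaces (P : Set E) : Set (Set E) := {F | F ∈ faces P ∧ F ≠ P}

theorem dim_lt_of_mem_properFaces [FiniteDimensional ℝ E] {P F : Set E}
    (hF : F ∈ properFaces P) : dim F < dim P := by
  obtain ⟨⟨⟨x, hx⟩, hexp⟩, hne⟩ := hF
  obtain ⟨l, hl⟩ := hexp ⟨x, hx⟩
  have hsub : F ⊆ P := by rw [hl]; exact fun y hy => hy.1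
  have hle : vectorSpan ℝ F ≤ vectorSpan ℝ P := vectorSpan_mono ℝ hsub
  refine Submodule.finrank_lt_finrank_of_lt (lt_of_le_of_ne hle fun heq => hne ?_)
  refine Set.Subset.antisymm hsub fun y hy => ?_
  have hker : vectorSpan ℝ F ≤ LinearMap.ker (l : E →ₗ[ℝ] ℝ) := by
    rw [vectorSpan_def, Submodule.span_le]
    rintro _ ⟨a, ha, b, hb, rfl⟩
    have ha' := ha
    have hb' := hb
    rw [hl] at ha' hb'
    have h1 := ha'.2 b hb'.1
    have h2 := hb'.2 a ha'.1
    simp only [SetLike.mem_coe, LinearMap.mem_ker, vsub_eq_sub, map_sub]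
    exact sub_eq_zero.2 (le_antisymm h2 h1)
  have hmem : y - x ∈ vectorSpan ℝ F := by
    rw [heq]; exact vsub_mem_vectorSpan ℝ hy (hsub hx)
  have h0 : l (y - x) = 0 := hker hmem
  rw [map_sub, sub_eq_zero] at h0
  have hx' := hx
  rw [hl] at hx' ⊢
  exact ⟨hy, fun z hz => h0 ▸ hx'.2 z hz⟩

/-- The simultaneous recursion, on the dimension of `P` and on `n`, behind the polytope numbers
`P(n)` (flag `false`) and the interior polytope numbers of `P` (flag `true`). The function `v`
gives the apex `v F` of each face `F`. -/
def numberAux [FiniteDimensional ℝ E] (v : Set E → E) (interior : Bool) (P : Set E) (n : ℕ) : ℤ :=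
  match n with
  | 0 => 0
  | 1 => if dim P = 0 then 1 else if interior then 0 else 1
  | n + 2 =>
    if dim P = 0 then 1
    else match interior with
      | false => numberAux v false P (n + 1) +
          ∑ᶠ (F : Set E) (_ : F ∈ properFaces P ∧ v P ∉ F), numberAux v true F (n + 2)
      | true => numberAux v false P (n + 2) -
          ∑ᶠ (F : Set E) (_ : F ∈ properFaces P), numberAux v true F (n + 2)
termination_by (dim P, n, interior.toNat)
decreasing_by
  · exact Prod.Lex.right _ (Prod.Lex.left _ _ (by omega))
  · exact Prod.Lex.left _ _ (dim_lt_of_mem_properFaces (by tauto))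
  · exact Prod.Lex.right _ (Prod.Lex.right _ (by simp))
  · exact Prod.Lex.left _ _ (dim_lt_of_mem_properFaces (by assumption))

/-- The polytope numbers `P(n)` with respect to the apexes `v`. -/
def polytopeNumber [FiniteDimensional ℝ E] (v : Set E → E) (P : Set E) (n : ℕ) : ℤ :=
  numberAux v false P n

/-- The interior polytope numbers of `P` with respect to the apexes `v`. -/
def interiorNumber [FiniteDimensional ℝ E] (v : Set E → E) (P : Set E) (n : ℕ) : ℤ :=
  numberAux v true P n

/-! The recursion in its usual form. -/

section Recursion

variable [FiniteDimensional ℝ E] (v : Set E → E) (P : Set E)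

theorem polytopeNumber_zero : polytopeNumber v P 0 = 0 := by
  rw [polytopeNumber, numberAux]

theorem interiorNumber_zero : interiorNumber v P 0 = 0 := by
  rw [interiorNumber, numberAux]

theorem polytopeNumber_of_dim_eq_zero (hP : dim P = 0) (n : ℕ) (hn : 1 ≤ n) :
    polytopeNumber v P n = 1 := by
  match n, hn with
  | 1, _ => rw [polytopeNumber, numberAux, if_pos hP]
  | n + 2, _ => rw [polytopeNumber, numberAux, if_pos hP]

theorem interiorNumber_of_dim_eq_zero (hP : dim P = 0) (n : ℕ) (hn : 1 ≤ n) :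
    interiorNumber v P n = 1 := by
  match n, hn with
  | 1, _ => rw [interiorNumber, numberAux, if_pos hP]
  | n + 2, _ => rw [interiorNumber, numberAux, if_pos hP]

theorem polytopeNumber_one : polytopeNumber v P 1 = 1 := by
  rw [polytopeNumber, numberAux]; simp

theorem interiorNumber_one (hP : dim P ≠ 0) : interiorNumber v P 1 = 0 := by
  rw [interiorNumber, numberAux]; simp [hP]

theorem polytopeNumber_add_two (hP : dim P ≠ 0) (n : ℕ) :
    polytopeNumber v P (n + 2) = polytopeNumber v P (n + 1) +
      ∑ᶠ (F : Set E) (_ : F ∈ properFaces P ∧ v P ∉ F), interiorNumber v F (n + 2) := by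
  rw [polytopeNumber, numberAux, if_neg hP]; rfl

theorem interiorNumber_add_two (hP : dim P ≠ 0) (n : ℕ) :
    interiorNumber v P (n + 2) = polytopeNumber v P (n + 2) -
      ∑ᶠ (F : Set E) (_ : F ∈ properFaces P), interiorNumber v F (n + 2) := by
  rw [interiorNumber, numberAux, if_neg hP]; rfl

end Recursion

/-- `v` chooses an apex of each nonempty face of `P`: a vertex of that face, where two faces whose
apexes both lie in their intersection have the same apex. -/
structure IsApexChoice (v : Set E → E) (P : Set E) : Prop where
  mem_vert : ∀ F ∈ faces P, v F ∈ F.extremePoints ℝ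
  compatible : ∀ F₁ ∈ faces P, ∀ F₂ ∈ faces P,
    v F₁ ∈ F₁ ∩ F₂ → v F₂ ∈ F₁ ∩ F₂ → v F₁ = v F₂

/-- The (nonempty) simplices of `C`, given by their vertex sets, that lie in `F`. -/
def simplicesIn (C : Geometry.SimplicialComplex ℝ E) (F : Set E) : Set (Finset E) :=
  {s | s ∈ C.faces ∧ convexHull ℝ (s : Set E) ⊆ F}

/-- `C` is a pointed triangulation of `P` with the apexes `v F`, `F` a nonempty face of `P`. -/
structure IsPointedTriangulation (C : Geometry.SimplicialComplex ℝ E) (v : Set E → E)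
    (P : Set E) : Prop where
  finite : C.faces.Finite
  space_eq : C.space = P
  apexChoice : IsApexChoice v P
  /-- `C` restricts to a triangulation of each nonempty face `F` of `P`, -/
  face_space_eq : ∀ F ∈ faces P, ⋃ s ∈ simplicesIn C F, convexHull ℝ (s : Set E) = F
  /-- which is pure of dimension `dim F`, -/
  face_pure : ∀ F ∈ faces P, ∀ s ∈ simplicesIn C F,
    ∃ t ∈ simplicesIn C F, s ⊆ t ∧ t.card = dim F + 1
  /-- and whose simplices of that dimension all contain the apex of `F`. -/
  apex_mem : ∀ F ∈ faces P, ∀ t ∈ simplicesIn C F, t.card = dim F + 1 →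
    v F ∈ convexHull ℝ (t : Set E)
  /-- The segment from the apex of `F` to any other vertex of `F` is an edge of `C`. -/
  edge_mem : ∀ F ∈ faces P, ∀ w ∈ F.extremePoints ℝ, w ≠ v F →
    ∃ s ∈ simplicesIn C F, (s : Set E) = {v F, w}

/-- The number of `k`-simplices of `C`. -/
def numSimplices (C : Geometry.SimplicialComplex ℝ E) (k : ℕ) : ℕ :=
  Set.ncard {s | s ∈ C.faces ∧ s.card = k + 1}

/-- The point set (convex hull of the vertices) of a `k`-simplex. -/
def simplexSet {k : ℕ} (σ : Affine.Simplex ℝ E k) : Set E :=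
  convexHull ℝ (Set.range σ.points)

end

end Polytope

namespace Polytope

variable {E : Type*} [NormedAddCommGroup E] [NormedSpace ℝ E]

/-- **Farkas' lemma** for finitely many vectors. -/
theorem farkas {ι : Type*} (s : Finset ι) (a : ι → E) (b : E)
    (h : ∀ l : StrongDual ℝ E, (∀ i ∈ s, l (a i) ≤ 0) → l b ≤ 0) :
    ∃ c : ι → ℝ, (∀ i ∈ s, 0 ≤ c i) ∧ ∑ i ∈ s, c i • a i = b := by
  classical
  induction s using Finset.induction generalizing a b with
  | empty =>
    refine ⟨0, by simp, ?_⟩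
    by_contra hb
    obtain ⟨l, hl⟩ := SeparatingDual.exists_eq_one (R := ℝ) (x := b) (by simpa using Ne.symm hb)
    have := h l (by simp)
    linarith
  | insert j s hj ih =>
    by_cases hs : ∀ l : StrongDual ℝ E, (∀ i ∈ s, l (a i) ≤ 0) → l b ≤ 0
    · obtain ⟨c, hc, hcb⟩ := ih a b hs
      refine ⟨fun i => if i ∈ s then c i else 0, fun i _ => ?_, ?_⟩
      · dsimp only
        split_ifs with hi
        exacts [hc i hi, le_rfl]
      · simp only [Finset.sum_insert hj, if_neg hj]
        rw [zero_smul, zero_add, ← hcb]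
        exact Finset.sum_congr rfl fun i hi => by rw [if_pos hi]
    · push Not at hs
      obtain ⟨l₀, hl₀, hb⟩ := hs
      have hpos : 0 < l₀ (a j) := by
        by_contra! hneg
        exact absurd (h l₀ fun i hi => (Finset.mem_insert.1 hi).elim (fun e => e ▸ hneg) (hl₀ i))
          (not_le.2 hb)
      set r : E → ℝ := fun x => l₀ x / l₀ (a j) with hr
      obtain ⟨c, hc, hcb⟩ := ih (fun i => a i - r (a i) • a j) (b - r b • a j) fun l hl => by
        have := h (l - (l (a j) / l₀ (a j)) • l₀) fun i hi => by
          rcases Finset.mem_insert.1 hi with rfl | hi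
          · simp [hpos.ne']
          · have := hl i hi
            simp only [map_sub, map_smul, smul_eq_mul, hr] at this
            simp only [sub_apply, FunLike.coe_smul, Pi.smul_apply, smul_eq_mul]
            convert this using 2
            ring
        simp only [sub_apply, FunLike.coe_smul, Pi.smul_apply, smul_eq_mul] at this
        simp only [map_sub, map_smul, smul_eq_mul, hr]
        convert this using 2
        ring
      refine ⟨fun i => if i ∈ s then c i else r b - ∑ i ∈ s, c i * r (a i), fun i _ => ?_, ?_⟩
      · dsimp only
        split_ifs with hi
        · exact hc i hi
        · have h1 : ∑ i ∈ s, c i * r (a i) ≤ 0 := Finset.sum_nonpos fun i hi =>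
            mul_nonpos_of_nonneg_of_nonpos (hc i hi)
              (div_nonpos_of_nonpos_of_nonneg (hl₀ i hi) hpos.le)
          have h2 : 0 < r b := div_pos hb hpos
          linarith
      · simp only [Finset.sum_insert hj, if_neg hj]
        rw [Finset.sum_congr rfl (g := fun i => c i • a i) fun i hi => by rw [if_pos hi]]
        simp only [smul_sub, Finset.sum_sub_distrib, smul_smul, ← Finset.sum_smul] at hcb
        rw [sub_smul]
        rw [← sub_eq_zero] at hcb ⊢
        rw [← hcb]
        abel

theorem convexHull_le {s : Set E} (l : StrongDual ℝ E) {c : ℝ} (h : ∀ x ∈ s, l x ≤ c) {x : E}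
    (hx : x ∈ convexHull ℝ s) : l x ≤ c :=
  convexHull_min (t := {x | l x ≤ c}) h (convex_halfSpace_le l.toLinearMap.isLinear c) hx

/-- A point of a polytope at which a segment from `v` cannot be prolonged lies on a face that
misses `v`. -/
theorem exists_face_notMem_of_not_prolongable (s : Finset E) {x v : E}
    (hx : x ∈ convexHull ℝ (s : Set E))
    (h : ∀ ε : ℝ, 0 < ε → x + ε • (x - v) ∉ convexHull ℝ (s : Set E)) :
    ∃ G ∈ faces (convexHull ℝ (s : Set E)), x ∈ G ∧ v ∉ G := by
  by_cases hl : ∀ l : StrongDual ℝ E, (∀ p ∈ s, l (p - x) ≤ 0) → l (x - v) ≤ 0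
  · obtain ⟨c, hc, hcb⟩ := farkas s (fun p => p - x) (x - v) hl
    exfalso
    set Λ := ∑ p ∈ s, c p with hΛ
    have hΛ0 : 0 ≤ Λ := Finset.sum_nonneg hc
    refine h (1 / (1 + Λ)) (by positivity) ?_
    rcases hΛ0.eq_or_lt with h0 | h0
    · have hz : ∀ p ∈ s, c p = 0 := (Finset.sum_eq_zero_iff_of_nonneg hc).1 h0.symm
      rw [← hcb, Finset.sum_eq_zero fun p hp => by rw [hz p hp, zero_smul]]
      simpa using hx
    · have hy : s.centerMass c id ∈ convexHull ℝ (s : Set E) :=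
        s.centerMass_mem_convexHull hc h0 fun p hp => hp
      have key := (convex_convexHull ℝ (s : Set E)) hx hy (a := 1 / (1 + Λ)) (b := Λ / (1 + Λ))
        (by positivity) (by positivity) (by field_simp)
      convert key using 1
      rw [← hcb, Finset.centerMass]
      simp only [smul_sub, Finset.sum_sub_distrib, ← Finset.sum_smul, ← hΛ, id]
      rw [smul_smul, smul_smul]
      have e1 : Λ / (1 + Λ) * Λ⁻¹ = 1 / (1 + Λ) := by field_simp
      have e2 : 1 / (1 + Λ) * Λ = 1 - 1 / (1 + Λ) := by field_simp; ring
      rw [e1, e2, sub_smul, one_smul]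
      abel
  · push Not at hl
    obtain ⟨l, hl, hlv⟩ := hl
    have hmax : ∀ y ∈ convexHull ℝ (s : Set E), l y ≤ l x := fun y hy =>
      convexHull_le l (fun p hp => by have := hl p hp; rw [map_sub] at this; linarith) hy
    refine ⟨{y ∈ convexHull ℝ (s : Set E) | ∀ z ∈ convexHull ℝ (s : Set E), l z ≤ l y},
      ⟨⟨x, hx, hmax⟩, fun _ => ⟨l, rfl⟩⟩, ⟨hx, hmax⟩, fun hv' => ?_⟩
    have := hv'.2 x hx
    rw [map_sub] at hlv
    linarith

theorem subset_of_mem_faces {P F : Set E} (hF : F ∈ faces P) : F ⊆ P := hF.2.subset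

theorem mem_faces_self {P : Set E} (hP : P.Nonempty) : P ∈ faces P := ⟨hP, .refl P⟩

theorem IsPolytope.nonempty {P : Set E} (hP : IsPolytope P) : P.Nonempty := by
  obtain ⟨s, hs, rfl⟩ := hP
  exact hs.to_set.convexHull

theorem IsPolytope.convex {P : Set E} (hP : IsPolytope P) : Convex ℝ P := by
  obtain ⟨s, hs, rfl⟩ := hP
  exact convex_convexHull ℝ _

theorem mem_faces_of_subset {P F G : Set E} (hF : F ∈ faces P) (hG : G ∈ faces P) (h : G ⊆ F) :
    G ∈ faces F :=
  ⟨hG.1, hG.2.mono (subset_of_mem_faces hF) h⟩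

theorem inter_mem_faces {P F G : Set E} (hF : F ∈ faces P) (hG : G ∈ faces P)
    (h : (F ∩ G).Nonempty) : F ∩ G ∈ faces P :=
  ⟨h, hF.2.inter hG.2⟩

theorem mem_faces_trans {P F G : Set E} (hP : IsPolytope P) (hF : F ∈ faces P)
    (hG : G ∈ faces F) : G ∈ faces P := by
  obtain ⟨s, -, rfl⟩ := hP
  set P := convexHull ℝ (s : Set E)
  have hFP := subset_of_mem_faces hF
  have hGF := subset_of_mem_faces hG
  obtain ⟨l, hl⟩ := hF.2 hF.1
  obtain ⟨l', hl'⟩ := hG.2 hG.1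
  obtain ⟨g, hg⟩ := hG.1
  have hgF := hGF hg
  have hgm : ∀ y ∈ P, l y ≤ l g := by rw [hl] at hgF; exact hgF.2
  have hgm' : ∀ y ∈ F, l' y ≤ l' g := by rw [hl'] at hg; exact hg.2
  have hmemF : ∀ y ∈ P, l g ≤ l y → y ∈ F := fun y hy h => by
    rw [hl]; exact ⟨hy, fun z hz => (hgm z hz).trans h⟩
  obtain ⟨K, hK⟩ : ∃ K : ℝ, ∀ p ∈ s, K * l p + l' p ≤ K * l g + l' g := by
    have : ∀ᶠ K : ℝ in Filter.atTop, ∀ p ∈ s, K * l p + l' p ≤ K * l g + l' g := by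
      rw [Filter.eventually_all_finset]
      intro p hp
      have hpP : p ∈ P := subset_convexHull ℝ _ hp
      rcases (hgm p hpP).eq_or_lt with h | h
      · have := hgm' p (hmemF p hpP h.ge)
        exact Filter.Eventually.of_forall fun K => by rw [h]; linarith
      · filter_upwards [Filter.eventually_ge_atTop ((l' p - l' g) / (l g - l p))] with K hK
        rw [div_le_iff₀ (by linarith)] at hK
        linarith
    exact this.exists
  have hKP : ∀ y ∈ P, K * l y + l' y ≤ K * l g + l' g := fun y hy => by
    simpa using convexHull_le (K • l + l') (c := K * l g + l' g) (by simpa using hK) hy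
  refine ⟨⟨g, hg⟩, fun _ => ⟨(K + 1) • l + l', ?_⟩⟩
  ext y
  simp only [Set.mem_ofPred_eq, add_apply, FunLike.coe_smul, Pi.smul_apply, smul_eq_mul]
  constructor
  · intro hy
    have h1 := hgm g (hFP hgF)
    have hyF := hGF hy
    have h2 : l g ≤ l y := by rw [hl] at hyF; exact hyF.2 g (hFP hgF)
    have h3 : l' g ≤ l' y := by rw [hl'] at hy; exact hy.2 g hgF
    have h4 := hgm y (hFP hyF)
    have h5 : l y = l g := le_antisymm h4 h2
    refine ⟨hFP hyF, fun z hz => ?_⟩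
    have := hKP z hz
    have := hgm z hz
    rw [h5]
    linarith
  · rintro ⟨hy, hmax⟩
    have h1 := hmax g (hFP hgF)
    have h2 := hKP y hy
    have h3 := hgm y hy
    have h4 : l y = l g := by linarith
    have hyF := hmemF y hy h4.ge
    rw [h4] at h1
    rw [hl']
    exact ⟨hyF, fun z hz => (hgm' z hz).trans (by linarith)⟩

theorem face_eq_convexHull {s : Finset E} {F : Set E}
    (hF : F ∈ faces (convexHull ℝ (s : Set E))) : F = convexHull ℝ ((s : Set E) ∩ F) := by
  have hc := hF.2.convex (convex_convexHull ℝ (s : Set E))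
  refine Set.Subset.antisymm ?_ (convexHull_min Set.inter_subset_right hc)
  have hcomp : IsCompact F := hF.2.isCompact (s.finite_toSet.isCompact_convexHull ℝ)
  have hsub : F.extremePoints ℝ ⊆ (s : Set E) ∩ F := fun x hx =>
    ⟨extremePoints_convexHull_subset (hF.2.isExtreme.extremePoints_subset_extremePoints hx), hx.1⟩
  conv_lhs => rw [← closure_convexHull_extremePoints hcomp hc]
  exact closure_minimal (convexHull_mono hsub)
    ((s.finite_toSet.inter_of_left F).isClosed_convexHull ℝ)

theorem IsPolytope.of_mem_faces {P F : Set E} (hP : IsPolytope P) (hF : F ∈ faces P) :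
    IsPolytope F := by
  obtain ⟨s, -, rfl⟩ := hP
  have h := face_eq_convexHull hF
  refine ⟨(s.finite_toSet.inter_of_left F).toFinset, ?_, by simpa using h⟩
  have := hF.1
  rw [h, convexHull_nonempty_iff] at this
  simpa using this

theorem IsPolytope.finite_faces {P : Set E} (hP : IsPolytope P) : (faces P).Finite := by
  obtain ⟨s, -, rfl⟩ := hP
  refine (s.finite_toSet.finite_subsets.image (convexHull ℝ)).subset fun F hF => ?_
  exact ⟨(s : Set E) ∩ F, Set.inter_subset_left, (face_eq_convexHull hF).symm⟩

/-- The smallest face containing a given subset. -/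
theorem exists_least_face {P : Set E} (hP : IsPolytope P) {t : Set E} (ht : t.Nonempty)
    (htP : t ⊆ P) : ∃ G ∈ faces P, t ⊆ G ∧ ∀ F ∈ faces P, t ⊆ F → G ⊆ F := by
  obtain ⟨G, hG⟩ := (hP.finite_faces.subset (t := {F | F ∈ faces P ∧ t ⊆ F})
    fun F hF => hF.1).exists_minimal ⟨P, mem_faces_self hP.nonempty, htP⟩
  refine ⟨G, hG.prop.1, hG.prop.2, fun F hF htF => ?_⟩
  have hsub := Set.subset_inter hG.prop.2 htF
  exact (hG.le_of_le ⟨inter_mem_faces hG.prop.1 hF (ht.mono hsub), hsub⟩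
    Set.inter_subset_left).trans Set.inter_subset_right

theorem sum_choose_succ {α : Type*} {D : Finset (Finset α)} (hD : ∀ s ∈ D, s.Nonempty) (n : ℕ) :
    ∑ s ∈ D, ((n + 1).choose s.card : ℤ) =
      ∑ s ∈ D, (n.choose s.card : ℤ) + ∑ s ∈ D, (n.choose (s.card - 1) : ℤ) := by
  rw [← Finset.sum_add_distrib]
  refine Finset.sum_congr rfl fun s hs => ?_
  have := (hD s hs).card_pos
  obtain ⟨k, hk⟩ : ∃ k, s.card = k + 1 := ⟨s.card - 1, by omega⟩
  rw [hk, Nat.choose_succ_succ]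
  push_cast
  simp [add_comm]

open scoped Classical in
/-- A finite family of nonempty vertex sets of simplices in `P` that is, in each face `F` of `P`, a
cone with apex `v F` over the members which lie in a face of `F` not containing `v F`. -/
structure IsConeFamily (C : Finset (Finset E)) (v : Set E → E) (P : Set E) : Prop where
  nonempty : ∀ s ∈ C, s.Nonempty
  subset : ∀ s ∈ C, (s : Set E) ⊆ P
  apex_mem : ∀ F ∈ faces P, v F ∈ F
  singleton_mem : ∀ F ∈ faces P, {v F} ∈ C
  insert_mem : ∀ F ∈ faces P, ∀ s ∈ C, (s : Set E) ⊆ F → insert (v F) s ∈ C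
  erase_mem : ∀ s ∈ C, ∀ x, (s.erase x).Nonempty → s.erase x ∈ C
  exists_face : ∀ F ∈ faces P, ∀ s ∈ C, (s : Set E) ⊆ F → v F ∉ s →
    ∃ G ∈ faces P, G ⊆ F ∧ (s : Set E) ⊆ G ∧ v F ∉ G

namespace IsConeFamily

variable {C : Finset (Finset E)} {v : Set E → E} {P : Set E}

open scoped Classical in
/-- A cone is made of its base, the joins of the base with the apex, and the apex. -/
theorem sum_choose_eq (hC : IsConeFamily C v P) {F : Set E} (hF : F ∈ faces P) (n : ℕ) :
    ∑ s ∈ C.filter fun s : Finset E => (s : Set E) ⊆ F, (n.choose (s.card - 1) : ℤ) =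
      1 + ∑ s ∈ C.filter fun s : Finset E => (s : Set E) ⊆ F ∧ v F ∉ s, ((n + 1).choose s.card : ℤ) := by
  rw [← Finset.sum_filter_not_add_sum_filter _ (fun s => v F ∈ s)]
  rw [Finset.filter_filter, Finset.filter_filter]
  have h1 : ∑ s ∈ C.filter fun s : Finset E => (s : Set E) ⊆ F ∧ v F ∈ s, (n.choose (s.card - 1) : ℤ) =
      1 + ∑ s ∈ C.filter fun s : Finset E => (s : Set E) ⊆ F ∧ v F ∉ s, (n.choose s.card : ℤ) := by
    have hmem : {v F} ∈ C.filter fun s : Finset E => (s : Set E) ⊆ F ∧ v F ∈ s := by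
      simp [hC.singleton_mem F hF, hC.apex_mem F hF]
    rw [← Finset.add_sum_erase _ _ hmem]
    congr 1
    · simp
    refine Finset.sum_bij' (fun s _ => s.erase (v F)) (fun s _ => insert (v F) s) ?_ ?_ ?_ ?_ ?_
    · intro s hs
      simp only [Finset.mem_erase, Finset.mem_filter] at hs
      simp only [Finset.mem_filter]
      refine ⟨hC.erase_mem s hs.2.1 _ ?_, ?_, by simp⟩
      · rw [Finset.nonempty_iff_ne_empty]
        intro h
        rw [Finset.erase_eq_empty_iff] at h
        rcases h with h | h
        · simp [h] at hs
        · exact hs.1 h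
      · exact (Finset.coe_subset.2 (Finset.erase_subset _ _)).trans hs.2.2.1
    · intro s hs
      simp only [Finset.mem_filter] at hs
      simp only [Finset.mem_erase, Finset.mem_filter]
      refine ⟨fun h => ?_, hC.insert_mem F hF s hs.1 hs.2.1, ?_, by simp⟩
      · obtain ⟨x, hx⟩ := hC.nonempty s hs.1
        have : x ∈ ({v F} : Finset E) := h ▸ Finset.mem_insert_of_mem hx
        rw [Finset.mem_singleton] at this
        exact hs.2.2 (this ▸ hx)
      · rw [Finset.coe_insert, Set.insert_subset_iff]
        exact ⟨hC.apex_mem F hF, hs.2.1⟩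
    · intro s hs
      simp only [Finset.mem_erase, Finset.mem_filter] at hs
      exact Finset.insert_erase hs.2.2.2
    · intro s hs
      simp only [Finset.mem_filter] at hs
      exact Finset.erase_insert hs.2.2
    · intro s hs
      simp only [Finset.mem_erase, Finset.mem_filter] at hs
      rw [Finset.card_erase_of_mem hs.2.2.2]
  rw [h1, add_left_comm, add_comm (Finset.sum _ _),
    ← sum_choose_succ fun s hs => hC.nonempty s (Finset.mem_filter.1 hs).1]

open scoped Classical in
theorem sum_finsum_faces (hP : IsPolytope P) (c : Finset E → Set E) (f : Finset E → ℤ)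
    (q : Set E → Prop) [DecidablePred q] (hq : ∀ G, q G → G ∈ faces P) (g : Set E → ℤ)
    (hg : ∀ G, q G → g G = ∑ s ∈ C with c s = G, f s) :
    ∑ᶠ (G : Set E) (_ : q G), g G = ∑ s ∈ C with q (c s), f s := by
  have hfin : {G | q G}.Finite := hP.finite_faces.subset hq
  change ∑ᶠ (G : Set E) (_ : G ∈ {G | q G}), _ = _
  rw [finsum_mem_congr (s := {G | q G}) rfl hg, finsum_mem_eq_finite_toFinset_sum _ hfin]
  rw [Finset.sum_filter]
  simp only [Finset.sum_filter]
  rw [Finset.sum_comm]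
  refine Finset.sum_congr rfl fun s _ => ?_
  rw [Finset.sum_ite_eq]
  simp

open scoped Classical in
/-- The polytope numbers of a face count the simplices of a cone family in that face, and its
interior polytope numbers those whose smallest face it is. -/
theorem numbers_eq [FiniteDimensional ℝ E] (hC : IsConeFamily C v P) (hP : IsPolytope P)
    {c : Finset E → Set E} (hc : ∀ s ∈ C, c s ∈ faces P ∧ (s : Set E) ⊆ c s ∧
      ∀ F ∈ faces P, (s : Set E) ⊆ F → c s ⊆ F) (d : ℕ) :
    ∀ F ∈ faces P, dim F = d → ∀ n,
      polytopeNumber v F (n + 2) = ∑ s ∈ C.filter fun s : Finset E => (s : Set E) ⊆ F, (n.choose (s.card - 1) : ℤ) ∧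
      interiorNumber v F (n + 2) = ∑ s ∈ C with c s = F, (n.choose (s.card - 1) : ℤ) := by
  have hcs : ∀ s ∈ C, ∀ F ∈ faces P, (s : Set E) ⊆ F ↔ c s ⊆ F := fun s hs F hF =>
    ⟨(hc s hs).2.2 F hF, (hc s hs).2.1.trans⟩
  induction d using Nat.strong_induction_on with
  | _ d ih =>
  intro F hF hd
  have hproper : ∀ G, G ∈ properFaces F ↔ G ∈ faces P ∧ G ⊆ F ∧ G ≠ F := fun G =>
    ⟨fun h => ⟨mem_faces_trans hP hF h.1, subset_of_mem_faces h.1, h.2⟩,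
      fun h => ⟨mem_faces_of_subset hF h.1 h.2.1, h.2.2⟩⟩
  have hint : ∀ n, ∀ G ∈ properFaces F, interiorNumber v G (n + 2) =
      ∑ s ∈ C with c s = G, (n.choose (s.card - 1) : ℤ) := fun n G hG =>
    (ih _ (hd ▸ dim_lt_of_mem_properFaces hG) G ((hproper G).1 hG).1 rfl n).2
  rcases Nat.eq_zero_or_pos d with rfl | hdpos
  · have hFs : F = {v F} := by
      refine Set.Subset.antisymm (fun x hx => ?_)
        (Set.singleton_subset_iff.2 (hC.apex_mem F hF))
      have hz : vectorSpan ℝ F = ⊥ := Submodule.finrank_eq_zero.1 hd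
      have := vsub_mem_vectorSpan ℝ hx (hC.apex_mem F hF)
      rw [hz, Submodule.mem_bot, vsub_eq_sub, sub_eq_zero] at this
      exact this
    have hsub : ∀ s ∈ C, (s : Set E) ⊆ F → s = {v F} := fun s hs h => by
      rw [hFs, ← Finset.coe_singleton, Finset.coe_subset] at h
      exact (Finset.Nonempty.subset_singleton_iff (hC.nonempty s hs)).1 h
    have hfilt1 : C.filter (fun s : Finset E => (s : Set E) ⊆ F) = {{v F}} := by
      ext s
      simp only [Finset.mem_filter, Finset.mem_singleton]
      refine ⟨fun h => hsub s h.1 h.2, ?_⟩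
      rintro rfl
      simp [hC.singleton_mem F hF, hC.apex_mem F hF]
    have hfilt2 : C.filter (fun s : Finset E => c s = F) = {{v F}} := by
      rw [← hfilt1]
      ext s
      simp only [Finset.mem_filter]
      refine and_congr_right fun hs => ⟨fun h => h ▸ (hc s hs).2.1, fun h => ?_⟩
      refine Set.Subset.antisymm ((hcs s hs F hF).1 h) ?_
      rw [hFs, Set.singleton_subset_iff]
      apply (hc s hs).2.1
      rw [hsub s hs h]
      simp
    intro n
    rw [polytopeNumber_of_dim_eq_zero v F hd _ (by omega),
      interiorNumber_of_dim_eq_zero v F hd _ (by omega), hfilt1, hfilt2]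
    simp
  have hd0 : dim F ≠ 0 := by omega
  have hpoly : ∀ n, polytopeNumber v F (n + 1) =
      1 + ∑ s ∈ C.filter fun s : Finset E => (s : Set E) ⊆ F ∧ v F ∉ s, (n.choose s.card : ℤ) := by
    intro n
    induction n with
    | zero =>
      rw [polytopeNumber_one, Finset.sum_eq_zero, add_zero]
      intro s hs
      have := (hC.nonempty s (Finset.mem_filter.1 hs).1).card_pos
      rw [Nat.choose_eq_zero_of_lt this, Nat.cast_zero]
    | succ n ihn =>
      rw [polytopeNumber_add_two v F hd0, ihn,
        sum_choose_succ fun s hs => hC.nonempty s (Finset.mem_filter.1 hs).1, add_assoc]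
      congr 2
      rw [sum_finsum_faces hP c _ (fun G => G ∈ properFaces F ∧ v F ∉ G)
        (fun G hG => ((hproper G).1 hG.1).1) _ fun G hG => hint n G hG.1]
      congr 1
      refine Finset.filter_congr fun s hs => ?_
      rw [hproper]
      constructor
      · rintro ⟨⟨-, h1, -⟩, h2⟩
        exact ⟨(hc s hs).2.1.trans h1, fun h => h2 ((hc s hs).2.1 h)⟩
      · rintro ⟨h1, h2⟩
        obtain ⟨G, hG, hGF, hsG, hvG⟩ := hC.exists_face F hF s hs h1 h2
        have hcG := (hc s hs).2.2 G hG hsG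
        exact ⟨⟨(hc s hs).1, hcG.trans hGF, fun h => hvG (hcG (h ▸ hC.apex_mem F hF))⟩,
          fun h => hvG (hcG h)⟩
  intro n
  have hp : polytopeNumber v F (n + 2) =
      ∑ s ∈ C.filter fun s : Finset E => (s : Set E) ⊆ F, (n.choose (s.card - 1) : ℤ) := by
    rw [hpoly, hC.sum_choose_eq hF]
  refine ⟨hp, ?_⟩
  rw [interiorNumber_add_two v F hd0, hp, sum_finsum_faces hP c _ (fun G => G ∈ properFaces F)
      (fun G hG => ((hproper G).1 hG).1) _ (hint n),
    sub_eq_iff_eq_add', ← Finset.sum_filter_add_sum_filter_not _ (fun s => c s ≠ F),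
    Finset.filter_filter, Finset.filter_filter]
  congr 1
  · congr 1
    refine Finset.filter_congr fun s hs => ?_
    rw [hproper, hcs s hs F hF]
    exact ⟨fun h => ⟨(hc s hs).1, h⟩, fun h => h.2⟩
  · congr 1
    refine Finset.filter_congr fun s hs => ?_
    rw [hcs s hs F hF, not_ne_iff]
    exact ⟨fun h => h.2, fun h => ⟨h.le, h⟩⟩

theorem polytopeNumber_eq [FiniteDimensional ℝ E] (hC : IsConeFamily C v P) (hP : IsPolytope P)
    (n : ℕ) : polytopeNumber v P (n + 2) = ∑ s ∈ C, (n.choose (s.card - 1) : ℤ) := by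
  classical
  choose! c hc using fun (s : Finset E) (hs : s ∈ C) =>
    exists_least_face hP (hC.nonempty s hs).to_set (hC.subset s hs)
  rw [(hC.numbers_eq hP hc _ P (mem_faces_self hP.nonempty) rfl n).1,
    Finset.filter_true_of_mem hC.subset]

end IsConeFamily

theorem weights_eq_of_affineIndependent {T : Finset E}
    (hT : AffineIndependent ℝ ((↑) : T → E)) {f g : E → ℝ}
    (h₀ : ∑ p ∈ T, f p = ∑ p ∈ T, g p) (h₁ : ∑ p ∈ T, f p • p = ∑ p ∈ T, g p • p) {p : E}
    (hp : p ∈ T) : f p = g p := by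
  have := affineIndependent_iff.1 hT Finset.univ (fun p => f p - g p)
    (by
      rw [Finset.sum_coe_sort T fun p => f p - g p, Finset.sum_sub_distrib, h₀, sub_self])
    (by
      rw [Finset.sum_coe_sort T fun p => (f p - g p) • p]
      simp only [sub_smul, Finset.sum_sub_distrib, h₁, sub_self])
    ⟨p, hp⟩ (Finset.mem_univ _)
  exact sub_eq_zero.1 this

/-- Going from a vertex `v` of a simplex through a point `x` of a face not containing `v`, one
leaves the simplex at `x`. -/
theorem not_prolongable_of_affineIndependent {T s : Finset E}
    (hT : AffineIndependent ℝ ((↑) : T → E)) (hs : s ⊆ T) {v x : E} (hv : v ∈ T) (hvs : v ∉ s)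
    (hx : x ∈ convexHull ℝ (s : Set E)) {ε : ℝ} (hε : 0 < ε) :
    x + ε • (x - v) ∉ convexHull ℝ (T : Set E) := by
  classical
  intro hy
  obtain ⟨w, hw0, hw1, hw⟩ := Finset.mem_convexHull'.1 hy
  obtain ⟨u, -, hu1, hu⟩ := Finset.mem_convexHull'.1 hx
  have := weights_eq_of_affineIndependent hT
    (f := fun p => w p + if p = v then ε else 0) (g := fun p => if p ∈ s then (1 + ε) * u p else 0)
    (by
      rw [Finset.sum_add_distrib, hw1, Finset.sum_ite_eq' T v, if_pos hv, ← Finset.sum_filter,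
        Finset.filter_mem_eq_inter, Finset.inter_eq_right.2 hs, ← Finset.mul_sum, hu1, mul_one])
    (by
      simp only [add_smul, Finset.sum_add_distrib, hw, ite_smul, zero_smul]
      rw [Finset.sum_ite_eq' T v, if_pos hv, ← Finset.sum_filter, Finset.filter_mem_eq_inter,
        Finset.inter_eq_right.2 hs]
      simp only [mul_smul, ← Finset.smul_sum, hu]
      module) hv
  simp only [if_true, if_neg hvs] at this
  linarith [hw0 v hv]

theorem centerMass_one_mem_convexHull {s : Finset E} (hs : s.Nonempty) :
    s.centerMass (fun _ => (1 : ℝ)) id ∈ convexHull ℝ (s : Set E) :=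
  s.centerMass_mem_convexHull (fun _ _ => zero_le_one) (by simpa using hs.card_pos) fun p hp => hp

theorem subset_of_centerMass_mem_convexHull {T s U : Finset E}
    (hT : AffineIndependent ℝ ((↑) : T → E)) (hs : s ⊆ T) (hne : s.Nonempty) (hU : U ⊆ T)
    (hx : s.centerMass (fun _ => (1 : ℝ)) id ∈ convexHull ℝ (U : Set E)) : s ⊆ U := by
  classical
  obtain ⟨w, -, hw1, hw⟩ := Finset.mem_convexHull'.1 hx
  have hcard : (s.card : ℝ) ≠ 0 := by simpa using hne.ne_empty
  intro p hp
  by_contra hpU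
  have := weights_eq_of_affineIndependent hT
    (f := fun p => if p ∈ U then w p else 0) (g := fun p => if p ∈ s then (s.card : ℝ)⁻¹ else 0)
    (by
      rw [← Finset.sum_filter, ← Finset.sum_filter, Finset.filter_mem_eq_inter,
        Finset.filter_mem_eq_inter, Finset.inter_eq_right.2 hs, Finset.inter_eq_right.2 hU, hw1,
        Finset.sum_const, nsmul_eq_mul, mul_inv_cancel₀ hcard])
    (by
      simp only [ite_smul, zero_smul]
      rw [← Finset.sum_filter, ← Finset.sum_filter, Finset.filter_mem_eq_inter,
        Finset.filter_mem_eq_inter, Finset.inter_eq_right.2 hs, Finset.inter_eq_right.2 hU, hw,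
        ← Finset.smul_sum, Finset.centerMass]
      simp) (hs hp)
  simp only [if_neg hpU, if_pos hp] at this
  exact inv_ne_zero hcard this.symm

/-- If the segment from `v` to the centroid of `s` cannot be prolonged in the polytope `F`, then
`s` lies in a face of `F` that misses `v`. -/
theorem exists_face_of_centerMass {F : Set E} (hF : IsPolytope F) {s : Finset E}
    (hne : s.Nonempty) (hs : (s : Set E) ⊆ F) {v : E}
    (h : ∀ ε : ℝ, 0 < ε → s.centerMass (fun _ => (1 : ℝ)) id +
      ε • (s.centerMass (fun _ => (1 : ℝ)) id - v) ∉ F) :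
    ∃ G ∈ faces F, (s : Set E) ⊆ G ∧ v ∉ G := by
  obtain ⟨S, -, rfl⟩ := hF
  set x := s.centerMass (fun _ => (1 : ℝ)) id with hx
  obtain ⟨G, hG, hxG, hvG⟩ := exists_face_notMem_of_not_prolongable S
    (convexHull_min hs (convex_convexHull ℝ _) (centerMass_one_mem_convexHull hne)) h
  refine ⟨G, hG, fun p hp => ?_, hvG⟩
  obtain ⟨l, hl⟩ := hG.2 hG.1
  have hcard : (s.card : ℝ) ≠ 0 := by simpa using hne.ne_empty
  rw [hl] at hxG ⊢
  have hsum : ∑ q ∈ s, (l x - l q) = 0 := by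
    have : l x = (s.card : ℝ)⁻¹ * ∑ q ∈ s, l q := by
      rw [hx, Finset.centerMass]
      simp
    rw [Finset.sum_sub_distrib, Finset.sum_const, nsmul_eq_mul, this, mul_inv_cancel_left₀ hcard,
      sub_self]
  have := (Finset.sum_eq_zero_iff_of_nonneg fun q hq => sub_nonneg.2 (hxG.2 q (hs hq))).1 hsum p hp
  exact ⟨hs hp, fun z hz => (hxG.2 z hz).trans (sub_nonpos.1 this.le)⟩

theorem mem_of_mem_extremePoints {F : Set E} {v : E} (hv : v ∈ F.extremePoints ℝ) {t : Set E}
    (ht : convexHull ℝ t ⊆ F) (hvt : v ∈ convexHull ℝ t) : v ∈ t :=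
  extremePoints_convexHull_subset (inter_extremePoints_subset_extremePoints_of_subset ht ⟨hvt, hv⟩)

open Classical in
theorem IsPointedTriangulation.isConeFamily {C : Geometry.SimplicialComplex ℝ E} {v : Set E → E}
    {P : Set E} (hP : IsPolytope P) (hC : IsPointedTriangulation C v P) :
    IsConeFamily hC.finite.toFinset v P := by
  have hsub : ∀ F ∈ faces P, ∀ s ∈ C.faces, (s : Set E) ⊆ F → s ∈ simplicesIn C F :=
    fun F hF s hs h => ⟨hs, convexHull_min h (hP.of_mem_faces hF).convex⟩
  have hapex : ∀ F ∈ faces P, ∀ t ∈ simplicesIn C F, t.card = dim F + 1 → v F ∈ t :=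
    fun F hF t ht hcard => mem_of_mem_extremePoints (hC.apexChoice.mem_vert F hF) ht.2
      (hC.apex_mem F hF t ht hcard)
  refine ⟨fun s hs => C.nonempty_of_mem_faces (hC.finite.mem_toFinset.1 hs),
    fun s hs => hC.space_eq ▸ C.subset_space (hC.finite.mem_toFinset.1 hs),
    fun F hF => (hC.apexChoice.mem_vert F hF).1, fun F hF => ?_, fun F hF s hs hsF => ?_,
    fun s hs x hx => ?_, fun F hF s hs hsF hvs => ?_⟩
  · rw [Set.Finite.mem_toFinset]
    obtain ⟨x, hx⟩ := hF.1
    rw [← hC.face_space_eq F hF] at hx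
    simp only [Set.mem_iUnion] at hx
    obtain ⟨s, hs, -⟩ := hx
    obtain ⟨t, ht, -, hcard⟩ := hC.face_pure F hF s hs
    exact C.down_closed ht.1 (Finset.singleton_subset_iff.2 (hapex F hF t ht hcard)) (by simp)
  · rw [Set.Finite.mem_toFinset] at hs ⊢
    obtain ⟨t, ht, hst, hcard⟩ := hC.face_pure F hF s (hsub F hF s hs hsF)
    exact C.down_closed ht.1 (Finset.insert_subset (hapex F hF t ht hcard) hst) (by simp)
  · rw [Set.Finite.mem_toFinset] at hs ⊢
    exact C.down_closed hs (Finset.erase_subset _ _) hx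
  · rw [Set.Finite.mem_toFinset] at hs
    obtain ⟨t, ht, hst, hcard⟩ := hC.face_pure F hF s (hsub F hF s hs hsF)
    have hvt := hapex F hF t ht hcard
    have hst' : s ⊆ t.erase (v F) := Finset.subset_erase.2 ⟨hst, hvs⟩
    have hne : (t.erase (v F)).Nonempty := (C.nonempty_of_mem_faces hs).mono hst'
    have htF : (t : Set E) ⊆ F := (subset_convexHull ℝ _).trans ht.2
    set x := (t.erase (v F)).centerMass (fun _ => (1 : ℝ)) id
    have hx : x ∈ convexHull ℝ (t.erase (v F) : Set E) := centerMass_one_mem_convexHull hne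
    obtain ⟨G, hG, htG, hvG⟩ := exists_face_of_centerMass (hP.of_mem_faces hF) hne
      ((Finset.coe_subset.2 (Finset.erase_subset _ _)).trans htF) (v := v F) fun ε hε hy => by
        have hy' : x + ε • (x - v F) ∈ ⋃ s ∈ simplicesIn C F, convexHull ℝ (s : Set E) := by
          rwa [hC.face_space_eq F hF]
        simp only [Set.mem_iUnion] at hy'
        obtain ⟨u', hu', hyu'⟩ := hy'
        obtain ⟨u, hu, huu, hucard⟩ := hC.face_pure F hF u' hu'
        have hyu := convexHull_mono (Finset.coe_subset.2 huu) hyu'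
        have hvu : v F ∈ convexHull ℝ (u : Set E) :=
          subset_convexHull ℝ _ (hapex F hF u hu hucard)
        have hxu : x ∈ convexHull ℝ (u : Set E) := by
          have key := (convex_convexHull ℝ (u : Set E)) hyu hvu (a := 1 / (1 + ε))
            (b := ε / (1 + ε)) (by positivity) (by positivity) (by field_simp)
          convert key using 1
          have e : (1 : ℝ) / (1 + ε) * (1 + ε) = 1 := by field_simp
          calc x = ((1 : ℝ) / (1 + ε) * (1 + ε)) • x := by rw [e, one_smul]
            _ = _ := by
              rw [div_eq_mul_one_div ε]
              module
        have hxtu := C.inter_subset_convexHull ht.1 hu.1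
          ⟨convexHull_mono (Finset.coe_subset.2 (Finset.erase_subset _ _)) hx, hxu⟩
        rw [← Finset.coe_inter] at hxtu
        have hsubu := subset_of_centerMass_mem_convexHull (C.indep ht.1) (Finset.erase_subset _ _)
          hne Finset.inter_subset_left hxtu
        have htu : t ⊆ u := by
          rw [← Finset.insert_erase hvt]
          exact Finset.insert_subset (hapex F hF u hu hucard)
            (hsubu.trans Finset.inter_subset_right)
        rw [← Finset.eq_of_subset_of_card_le htu (by rw [hcard, hucard])] at hyu
        exact not_prolongable_of_affineIndependent (C.indep ht.1) (Finset.erase_subset _ _) hvt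
          (Finset.notMem_erase _ _) hx hε hyu
    exact ⟨G, mem_faces_trans hP hF hG, subset_of_mem_faces hG,
      (Finset.coe_subset.2 hst').trans htG, hvG⟩

theorem isConeFamily_powerset {T : Finset E} (hT : AffineIndependent ℝ ((↑) : T → E))
    (hne : T.Nonempty) {v : Set E → E} (hv : IsApexChoice v (convexHull ℝ (T : Set E))) :
    IsConeFamily (T.powerset.filter Finset.Nonempty) v (convexHull ℝ (T : Set E)) := by
  classical
  have hP : IsPolytope (convexHull ℝ (T : Set E)) := ⟨T, hne, rfl⟩
  have hapex : ∀ F ∈ faces (convexHull ℝ (T : Set E)), v F ∈ T := fun F hF =>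
    extremePoints_convexHull_subset
      (hF.2.isExtreme.extremePoints_subset_extremePoints (hv.mem_vert F hF))
  constructor
  · exact fun s hs => (Finset.mem_filter.1 hs).2
  · intro s hs
    rw [Finset.mem_filter, Finset.mem_powerset] at hs
    exact (Finset.coe_subset.2 hs.1).trans (subset_convexHull ℝ _)
  · exact fun F hF => (hv.mem_vert F hF).1
  · intro F hF
    simpa using hapex F hF
  · intro F hF s hs _
    rw [Finset.mem_filter, Finset.mem_powerset] at hs ⊢
    convert And.intro (Finset.insert_subset (hapex F hF) hs.1) (Finset.insert_nonempty _ _)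
  · intro s hs x hx
    rw [Finset.mem_filter, Finset.mem_powerset] at hs ⊢
    convert And.intro ((Finset.erase_subset _ _).trans hs.1) hx
  · intro F hF s hs hsF hvs
    rw [Finset.mem_filter, Finset.mem_powerset] at hs
    obtain ⟨G, hG, hsG, hvG⟩ := exists_face_of_centerMass (hP.of_mem_faces hF) hs.2 hsF
      (v := v F) fun ε hε hy => not_prolongable_of_affineIndependent hT hs.1 (hapex F hF) hvs
        (centerMass_one_mem_convexHull hs.2) hε (subset_of_mem_faces hF hy)
    exact ⟨G, mem_faces_trans hP hF hG, subset_of_mem_faces hG, hsG, hvG⟩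

theorem sum_range_choose_mul_choose (n k : ℕ) :
    ∑ j ∈ Finset.range (k + 1), (k + 1).choose (j + 1) * n.choose j = (n + (k + 1)).choose k := by
  rw [Nat.add_choose_eq, Finset.Nat.sum_antidiagonal_eq_sum_range_succ_mk]
  refine Finset.sum_congr rfl fun j hj => ?_
  have hj' : j + 1 ≤ k + 1 := by simpa using hj
  dsimp only
  rw [mul_comm, ← Nat.choose_symm hj', Nat.add_sub_add_right]

/-- The polytope numbers of a `k`-simplex. -/
theorem polytopeNumber_simplexSet [FiniteDimensional ℝ E] {k : ℕ} (σ : Affine.Simplex ℝ E k)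
    {v : Set E → E} (hv : IsApexChoice v (simplexSet σ)) (n : ℕ) :
    polytopeNumber v (simplexSet σ) (n + 1) = ((n + k).choose k : ℤ) := by
  classical
  rcases n with _ | n
  · rw [polytopeNumber_one]
    simp
  set T : Finset E := Finset.univ.image σ.points with hTdef
  have hTr : (T : Set E) = Set.range σ.points := by simp [hTdef]
  have hσ : simplexSet σ = convexHull ℝ (T : Set E) := by rw [hTr, simplexSet]
  have hcard : T.card = k + 1 := by
    rw [hTdef, Finset.card_image_of_injective _ σ.independent.injective, Finset.card_univ,
      Fintype.card_fin]
  have hT : AffineIndependent ℝ ((↑) : T → E) := by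
    have h := σ.independent.range
    rw [← hTr] at h
    exact h
  have hne : T.Nonempty := Finset.card_pos.1 (by omega)
  rw [hσ] at hv ⊢
  rw [(isConeFamily_powerset hT hne hv).polytopeNumber_eq ⟨T, hne, rfl⟩, Finset.sum_filter]
  have hsum := Finset.sum_powerset_apply_card
    (fun m => if m = 0 then (0 : ℤ) else (n.choose (m - 1) : ℤ)) (x := T)
  rw [hcard, Finset.sum_range_succ'] at hsum
  calc _ = ∑ s ∈ T.powerset, if s.card = 0 then (0 : ℤ) else (n.choose (s.card - 1) : ℤ) := by
        refine Finset.sum_congr rfl fun s _ => ?_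
        simp only [Finset.card_eq_zero, Finset.nonempty_iff_ne_empty, ite_not, ne_eq]
    _ = _ := by
        rw [hsum, add_assoc n 1 k, add_comm 1 k, ← sum_range_choose_mul_choose n k,
          Nat.cast_sum]
        simp

end Polytope

/-- `σ k` is an arbitrary `k`-simplex with an arbitrary choice `w k` of apexes; its polytope numbers
are the `k`-simplex numbers. They vanish at `0`, so the truncated subtraction `n - (k + 1)` says
that they are `0` at negative arguments. -/
theorem mainTheorem10 {E : Type*} [NormedAddCommGroup E] [NormedSpace ℝ E] [FiniteDimensional ℝ E]
    (P : Set E) (hP : Polytope.IsPolytope P)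
    (C : Geometry.SimplicialComplex ℝ E) (v : Set E → E)
    (hC : Polytope.IsPointedTriangulation C v P)
    (m : ℕ → ℕ) (σ : (k : ℕ) → Affine.Simplex ℝ (EuclideanSpace ℝ (Fin (m k))) k)
    (w : (k : ℕ) → Set (EuclideanSpace ℝ (Fin (m k))) → EuclideanSpace ℝ (Fin (m k)))
    (hw : ∀ k, Polytope.IsApexChoice (w k) (Polytope.simplexSet (σ k)))
    (n : ℕ) (hn : n ≠ 1) :
    Polytope.polytopeNumber v P n =
      ∑ k ∈ Finset.range (Polytope.dim P + 1),
        (Polytope.numSimplices C k : ℤ) *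
          Polytope.polytopeNumber (w k) (Polytope.simplexSet (σ k)) (n - (k + 1)) := by
  obtain rfl | ⟨n, rfl⟩ : n = 0 ∨ ∃ j, n = j + 2 := by
    rcases n with _ | _ | n
    exacts [.inl rfl, absurd rfl hn, .inr ⟨n, rfl⟩]
  · simp [Polytope.polytopeNumber_zero]
  have hα : ∀ k, Polytope.polytopeNumber (w k) (Polytope.simplexSet (σ k)) (n + 2 - (k + 1)) =
      (n.choose k : ℤ) := fun k => by
    rcases lt_or_ge n k with h | h
    · rw [Nat.sub_eq_zero_of_le (by omega), Polytope.polytopeNumber_zero,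
        Nat.choose_eq_zero_of_lt h, Nat.cast_zero]
    · obtain ⟨j, rfl⟩ := Nat.exists_eq_add_of_le' h
      rw [show j + k + 2 - (k + 1) = j + 1 by omega, Polytope.polytopeNumber_simplexSet _ (hw k)]
  simp only [hα]
  rw [(hC.isConeFamily hP).polytopeNumber_eq hP,
    ← Finset.sum_fiberwise_of_maps_to (t := Finset.range (Polytope.dim P + 1))
      (g := fun s : Finset E => s.card - 1)]
  · refine Finset.sum_congr rfl fun k _ => ?_
    rw [Finset.sum_congr rfl (g := fun _ => (n.choose k : ℤ)) fun s hs => by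
      rw [(Finset.mem_filter.1 hs).2], Finset.sum_const, nsmul_eq_mul, Polytope.numSimplices,
      ← Set.ncard_coe_finset]
    congr 3
    ext s
    simp only [Finset.coe_filter, Set.Finite.mem_toFinset, Set.mem_ofPred_eq]
    refine and_congr_right fun hs => ?_
    have := (C.nonempty_of_mem_faces hs).card_pos
    omega
  · intro s hs
    rw [Set.Finite.mem_toFinset] at hs
    have hPf := Polytope.mem_faces_self hP.nonempty
    obtain ⟨t, -, hst, ht⟩ := hC.face_pure P hPf s
      ⟨hs, hC.space_eq ▸ C.convexHull_subset_space hs⟩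
    have := Finset.card_le_card hst
    rw [Finset.mem_range]
    omega
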